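/- Let $m,n,t$ be integers with $m\ge 0$ and $1\le t\le n-1$, and let $\mathcal D$ be a data set of $n$ pairs $(r_j,\boldsymbol a_j)\in\mathbb R\times\mathbb R^m$, $1\le j\le n$, with $|r_j|\le\bar r$ and $\|\boldsymbol a_j\|_\infty\le\bar a$ for all $j$. Let $\sigma$ be a uniformly distributed random permutation of $\{1,\dots,n\}$, let $\mathbb E$ be the expectation with respect to $\sigma$, and write $(r_{\sigma(j)},\boldsymbol a_{\sigma(j)})$ for the $j$-th pair in the permuted order, where $a_{i\,\sigma(j)}$ is the $i$-th coordinate of $\boldsymbol a_{\sigma(j)}$. Let $I(\cdot)$ be the indicator function, and let $\boldsymbol p\ge 0$ range over all vectors of $\mathbb R^m$ with nonnegative coordinates. Then $$\mathbb{E}\left[\sup_{\boldsymbol p\ge 0}\left|\frac{1}{n-t}\sum_{j=t+1}^n r_{\sigma(j)}I\big(r_{\sigma(j)}>\boldsymbol a_{\sigma(j)}^\top\boldsymbol p\big)-\frac1t\sum_{j=1}^t r_{\sigma(j)}I\big(r_{\sigma(j)}>\boldsymbol a_{\sigma(j)}^\top\boldsymbol p\big)\right|\right]\le\frac{4\bar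 r}{\sqrt{\min\{t,n-t\}}}+\frac{2\sqrt{2\bar r^2 m\log n}}{\sqrt{\min\{t,n-t\}}},$$ and for every $1\le i\le m$ $$\mathbb{E}\left[\sup_{\boldsymbol p\ge 0}\left|\frac{1}{n-t}\sum_{j=t+1}^n a_{i\,\sigma(j)}I\big(r_{\sigma(j)}>\boldsymbol a_{\sigma(j)}^\top\boldsymbol p\big)-\frac1t\sum_{j=1}^t a_{i\,\sigma(j)}I\big(r_{\sigma(j)}>\boldsymbol a_{\sigma(j)}^\top\boldsymbol p\big)\right|\right]\le\frac{4\bar a}{\sqrt{\min\{t,n-t\}}}+\frac{2\sqrt{2\bar a^2 m\log n}}{\sqrt{\min\{t,n-t\}}}.$$ -/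

import Mathlib

namespace RandomPermutationLP

/-- The expectation of `X σ` for a permutation `σ` of the `n` indices that is uniformly distributed
over all `n!` permutations. -/
noncomputable def permExpectation {n : ℕ} (X : Equiv.Perm (Fin n) → ℝ) : ℝ :=
  (∑ σ : Equiv.Perm (Fin n), X σ) / (n.factorial : ℝ)

/-- The threshold decision `I(r > aᵀp)` for one column `(r, a)` at the dual price `p`. -/
noncomputable def accept {m : ℕ} (r : ℝ) (a p : Fin m → ℝ) : ℝ :=
  if r > a ⬝ᵥ p then 1 else 0

/-- The average of the first `t` terms of `x` (positions are numbered `0, …, n - 1`). -/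
noncomputable def prefixAvg {n : ℕ} (t : ℕ) (x : Fin n → ℝ) : ℝ :=
  1 / (t : ℝ) * ∑ j : Fin n with j.val < t, x j

/-- The average of the last `n - t` terms of `x`. -/
noncomputable def suffixAvg {n : ℕ} (t : ℕ) (x : Fin n → ℝ) : ℝ :=
  1 / ((n : ℝ) - (t : ℝ)) * ∑ j : Fin n with t ≤ j.val, x j

/-- The absolute gap between the suffix and the prefix average of `c_j I(r_j > a_jᵀp)`. -/
noncomputable def gap {m n : ℕ} (t : ℕ) (c r : Fin n → ℝ) (a : Fin n → Fin m → ℝ)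
    (p : Fin m → ℝ) : ℝ :=
  |suffixAvg t (fun j => c j * accept (r j) (a j) p)
    - prefixAvg t (fun j => c j * accept (r j) (a j) p)|

/-- The supremum of the gap over all nonnegative prices `p`. -/
noncomputable def supGap {m n : ℕ} (t : ℕ) (c r : Fin n → ℝ) (a : Fin n → Fin m → ℝ) : ℝ :=
  ⨆ p : {p : Fin m → ℝ // 0 ≤ p}, gap t c r a p.1

/-- The family over which `supGap` is taken is bounded, so that `supGap` is a genuine supremum. -/
theorem bddAbove_gap {m n : ℕ} (t : ℕ) (c r : Fin n → ℝ) (a : Fin n → Fin m → ℝ) :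
    BddAbove (Set.range fun p : {p : Fin m → ℝ // 0 ≤ p} => gap t c r a p.1) := by
  have key : ∀ (s : Finset (Fin n)) (p : Fin m → ℝ),
      |∑ j ∈ s, c j * accept (r j) (a j) p| ≤ ∑ j ∈ s, |c j| := by
    intro s p
    refine (Finset.abs_sum_le_sum_abs _ _).trans (Finset.sum_le_sum fun j _ => ?_)
    unfold accept
    split_ifs <;> simp
  refine ⟨|1 / ((n : ℝ) - (t : ℝ))| * (∑ j : Fin n with t ≤ j.val, |c j|)
    + |1 / (t : ℝ)| * ∑ j : Fin n with j.val < t, |c j|, ?_⟩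
  rintro _ ⟨p, rfl⟩
  refine (abs_sub _ _).trans ?_
  unfold suffixAvg prefixAvg
  rw [abs_mul, abs_mul]
  gcongr <;> exact key _ _

end RandomPermutationLP

/-! Prices matter only through the set of columns they accept. By LP-type duality, no more than `m`
columns can be shattered, so Sauer–Shelah leaves at most `2 * n ^ m` accepted sets
(`card_acceptFamily_le`), and the supremum becomes a maximum over a finite family.

For a finite family, index the shorter block by `α` and the longer one by `α ⊕ γ`. Averaging over
permutations of the longer block replaces its mean by the mean over a subblock of size `|α|`
(`sum_perm_sup'_avg_sub_le_sum`). Exchanging paired positions of the two equal blocks preserves the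
uniform law and introduces free random signs (`sum_perm_sup'_sum_sub_le`). Massart's lemma
(`sum_signs_sup'_abs_le`) then gives the rate `√(log |T| / |α|)`, without any independence
assumption. -/

namespace RandomPermutationLP

/-! ### Counting acceptance patterns by VC dimension. -/

/-- The sets of columns that are accepted at some nonnegative price. -/
noncomputable def acceptFamily {m n : ℕ} (r : Fin n → ℝ) (a : Fin n → Fin m → ℝ) :
    Finset (Finset (Fin n)) :=
  open Classical in
  {s | ∃ p : Fin m → ℝ, 0 ≤ p ∧ ∀ j, j ∈ s ↔ r j > a j ⬝ᵥ p}

/-- More than `m` vectors `a j` satisfy a relation `∑ g j • a j = 0`, which makes `∑ g j * (r j - a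
j ⬝ᵥ p)` independent of `p`. Accepting exactly the indices with `g j > 0`, or accepting none, forces
signs on this constant that are compatible, for both `g` and `-g`, only if `g = 0`. -/
theorem card_le_of_shatters_acceptFamily {m n : ℕ} {r : Fin n → ℝ} {a : Fin n → Fin m → ℝ}
    {s : Finset (Fin n)} (hs : (acceptFamily r a).Shatters s) : s.card ≤ m := by
  by_contra! hm
  have hdep : ¬ LinearIndependent ℝ (fun j : s => a j) := by
    intro h
    have := h.fintype_card_le_finrank
    simp at this
    omega
  obtain ⟨g, hg, i₀, hi₀⟩ := Fintype.not_linearIndependent_iff.1 hdep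
  -- the affine functions `r j - a j ⬝ᵥ p` on `s` satisfy a linear relation independent of `p`
  have hconst : ∀ p : Fin m → ℝ, ∑ j, g j * (r j - a j ⬝ᵥ p) = ∑ j, g j * r j := by
    intro p
    have h0 : ∑ j, g j * (a j ⬝ᵥ p) = 0 := by
      have := congrArg (· ⬝ᵥ p) hg
      simpa [sum_dotProduct, smul_dotProduct] using this
    simp only [mul_sub, Finset.sum_sub_distrib, h0, sub_zero]
  have hpat : ∀ P : s → Prop, ∃ p : Fin m → ℝ, ∀ j : s, P j ↔ r j > a j ⬝ᵥ p := by
    classical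
    intro P
    obtain ⟨u, hu, hsu⟩ := hs (t := (Finset.univ.filter P).map (Function.Embedding.subtype _))
      (by intro x hx; simp at hx; exact hx.1)
    obtain ⟨p, -, hp⟩ := by simpa [acceptFamily] using hu
    refine ⟨p, fun j => ?_⟩
    have := congrArg (fun v => (j : Fin n) ∈ v) hsu
    simp at this
    rw [← this]
    exact hp j
  have key : ∀ g : s → ℝ, (∀ p : Fin m → ℝ, ∑ j, g j * (r j - a j ⬝ᵥ p) = ∑ j, g j * r j) →
      ∑ j, g j * r j ≤ 0 → ∀ j, g j ≤ 0 := by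
    intro g hg hle
    by_contra! hpos
    obtain ⟨j₀, hj₀⟩ := hpos
    -- With this pattern every term is nonnegative, and the term at `j₀` is strictly positive
    -- because acceptance is strict.
    obtain ⟨p, hp⟩ := hpat (fun j => 0 < g j)
    have : 0 < ∑ j, g j * (r j - a j ⬝ᵥ p) := by
      refine Finset.sum_pos' (fun j _ => ?_) ⟨j₀, Finset.mem_univ _, ?_⟩
      · by_cases h : 0 < g j
        · exact mul_nonneg h.le (sub_nonneg.2 ((hp j).1 h).le)
        · have h' : r j ≤ a j ⬝ᵥ p := not_lt.1 (mt (hp j).2 h)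
          exact mul_nonneg_of_nonpos_of_nonpos (not_lt.1 h) (sub_nonpos.2 h')
      · exact mul_pos hj₀ (sub_pos.2 ((hp j₀).1 hj₀))
    linarith [hg p]
  have hneg : ∀ p : Fin m → ℝ, ∑ j, -g j * (r j - a j ⬝ᵥ p) = ∑ j, -g j * r j := by
    intro p; simpa [neg_mul, Finset.sum_neg_distrib] using hconst p
  have main : ∀ g : s → ℝ, (∀ p : Fin m → ℝ, ∑ j, g j * (r j - a j ⬝ᵥ p) = ∑ j, g j * r j) →
      ∑ j, g j * r j < 0 → False := by
    intro g hg hlt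
    have hg0 := key g hg hlt.le
    obtain ⟨p, hp⟩ := hpat (fun _ => False)
    have : 0 ≤ ∑ j, g j * (r j - a j ⬝ᵥ p) :=
      Finset.sum_nonneg fun j _ => mul_nonneg_of_nonpos_of_nonpos (hg0 j)
        (sub_nonpos.2 (not_lt.1 ((hp j).2)))
    linarith [hg p]
  have h1 := main g hconst
  have h2 := main (fun j => -g j) hneg
  have hzero : ∑ j, g j * r j = 0 := by
    simp only [neg_mul, Finset.sum_neg_distrib] at h2
    by_contra hne
    rcases lt_or_gt_of_ne hne with h | h
    · exact h1 h
    · exact h2 (by linarith)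
  have h3 := key g hconst hzero.le i₀
  have h4 := key (fun j => -g j) hneg (by simp only [neg_mul, Finset.sum_neg_distrib, hzero, neg_zero, le_refl]) i₀
  exact hi₀ (le_antisymm h3 (by linarith))

theorem sum_choose_le_two_mul_pow {n : ℕ} (hn : 2 ≤ n) (m : ℕ) :
    ∑ i ∈ Finset.Iic m, n.choose i ≤ 2 * n ^ m := by
  rw [← Nat.range_succ_eq_Iic]
  induction m with
  | zero => simp
  | succ m ih =>
    rw [Finset.sum_range_succ]
    calc _ ≤ 2 * n ^ m + n ^ (m + 1) := add_le_add ih (Nat.choose_le_pow n (m + 1))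
      _ ≤ n * n ^ m + n ^ (m + 1) := by gcongr
      _ = 2 * n ^ (m + 1) := by ring

/-- Pajor's form of Sauer–Shelah: a family has at most as many members as it shatters sets, and the
shattered sets have size at most `m`. -/
theorem card_acceptFamily_le {m n : ℕ} (hn : 2 ≤ n) (r : Fin n → ℝ) (a : Fin n → Fin m → ℝ) :
    (acceptFamily r a).card ≤ 2 * n ^ m := by
  have hvc : (acceptFamily r a).vcDim ≤ m :=
    Finset.sup_le fun s hs => card_le_of_shatters_acceptFamily (Finset.mem_shatterer.1 hs)
  calc _ ≤ (acceptFamily r a).shatterer.card := Finset.card_le_card_shatterer _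
    _ ≤ ∑ i ∈ Finset.Iic (acceptFamily r a).vcDim, (Fintype.card (Fin n)).choose i :=
      Finset.card_shatterer_le_sum_vcDim
    _ ≤ ∑ i ∈ Finset.Iic m, n.choose i := by
      rw [Fintype.card_fin]
      exact Finset.sum_le_sum_of_subset (Finset.Iic_subset_Iic.2 hvc)
    _ ≤ 2 * n ^ m := sum_choose_le_two_mul_pow hn m

/-! ### Rademacher sums and Massart's lemma. -/

/-- The moment generating function of a Rademacher sum is subgaussian. -/
theorem sum_signs_exp_le {α : Type*} [Fintype α] [DecidableEq α] (d : α → ℝ) {b : ℝ}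
    (hd : ∀ i, |d i| ≤ b) (l : ℝ) :
    ∑ E : α → Bool, Real.exp (l * ∑ i, (if E i then -1 else 1) * d i)
      ≤ 2 ^ Fintype.card α * Real.exp (l ^ 2 * Fintype.card α * b ^ 2 / 2) := by
  have h1 : ∀ E : α → Bool, Real.exp (l * ∑ i, (if E i then -1 else 1) * d i)
      = ∏ i, Real.exp (l * ((if E i then -1 else 1) * d i)) := by
    intro E
    rw [Finset.mul_sum, Real.exp_sum]
  have h2 := Finset.prod_univ_sum (fun _ : α => (Finset.univ : Finset Bool))
    (fun i e => Real.exp (l * ((if e then -1 else 1) * d i)))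
  rw [Fintype.piFinset_univ] at h2
  simp_rw [h1]
  rw [← h2]
  calc _ ≤ ∏ _i : α, 2 * Real.exp (l ^ 2 * b ^ 2 / 2) := by
        refine Finset.prod_le_prod (fun i _ => by positivity) fun i _ => ?_
        have h3 : ∑ e : Bool, Real.exp (l * ((if e then -1 else 1) * d i))
            = 2 * Real.cosh (l * d i) := by
          simp [Real.cosh_eq]
          ring
        rw [h3]
        gcongr
        refine (Real.cosh_le_exp_half_sq _).trans (Real.exp_le_exp.2 ?_)
        rw [mul_pow]
        have h4 : d i ^ 2 ≤ b ^ 2 := sq_le_sq.2 ((hd i).trans (le_abs_self b))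
        gcongr
    _ = _ := by
        rw [Finset.prod_const, Finset.card_univ, mul_pow, ← Real.exp_nat_mul]
        ring_nf

/-- **Massart's finite class lemma** for the sum over all sign vectors. -/
theorem sum_signs_sup'_abs_le {α κ : Type*} [Fintype α] [DecidableEq α] [Nonempty α]
    {T : Finset κ} (hT : T.Nonempty) (d : κ → α → ℝ) {b : ℝ} (hb : 0 < b)
    (hd : ∀ y ∈ T, ∀ i, |d y i| ≤ b) :
    ∑ E : α → Bool, T.sup' hT (fun y => |∑ i, (if E i then -1 else 1) * d y i|)
      ≤ 2 ^ Fintype.card α * (b * √(2 * Fintype.card α * Real.log (2 * T.card))) := by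
  set k : ℝ := (Fintype.card α : ℝ) with hk
  have hk0 : 0 < k := by rw [hk]; exact_mod_cast Fintype.card_pos
  have hN : (1 : ℝ) ≤ T.card := by exact_mod_cast hT.card_pos
  -- The factor 2 counts the two signs of the absolute value; it also keeps `L` positive when `T` is
  -- a singleton.
  set L := Real.log (2 * T.card) with hL
  have hL0 : 0 < L := Real.log_pos (by linarith)
  set Z : (α → Bool) → ℝ :=
    fun E => T.sup' hT (fun y => |∑ i, (if E i then -1 else 1) * d y i|) with hZ
  set s := b * √(2 * k * L) with hs
  have hs0 : 0 < s := by positivity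
  have hs2 : s ^ 2 = b ^ 2 * (2 * k * L) := by rw [hs, mul_pow, Real.sq_sqrt (by positivity)]
  -- The minimizer of `L / l + l * k * b ^ 2 / 2`, at which both terms are equal and their sum is
  -- `s`.
  set l := 2 * L / s with hl
  have hl0 : 0 < l := by positivity
  have hll : l ^ 2 * k * b ^ 2 / 2 = L := by
    rw [hl, div_pow, hs2]
    field_simp
  clear_value k L s l Z
  have hexp : ∀ E : α → Bool, Real.exp (l * Z E) ≤
      ∑ y ∈ T, (Real.exp (l * ∑ i, (if E i then -1 else 1) * d y i)
        + Real.exp (-l * ∑ i, (if E i then -1 else 1) * d y i)) := by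
    intro E
    obtain ⟨y, hy, hyZ⟩ :=
      T.exists_mem_eq_sup' hT (fun y => |∑ i, (if E i then -1 else 1) * d y i|)
    have h1 : Z E = |∑ i, (if E i then -1 else 1) * d y i| := by rw [hZ]; exact hyZ
    rw [h1]
    refine le_trans ?_ (Finset.single_le_sum (f := fun y =>
      Real.exp (l * ∑ i, (if E i then -1 else 1) * d y i)
        + Real.exp (-l * ∑ i, (if E i then -1 else 1) * d y i)) (fun _ _ => by positivity) hy)
    rcases abs_cases (∑ i, (if E i then -1 else 1) * d y i) with h | h
    · rw [h.1]
      exact le_add_of_nonneg_right (Real.exp_pos _).le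
    · rw [h.1, mul_neg, ← neg_mul]
      exact le_add_of_nonneg_left (Real.exp_pos _).le
  have hsum : ∑ E, Real.exp (l * Z E) ≤ 2 ^ Fintype.card α * (2 * T.card * Real.exp L) := by
    calc _ ≤ ∑ E : α → Bool, ∑ y ∈ T, (Real.exp (l * ∑ i, (if E i then -1 else 1) * d y i)
        + Real.exp (-l * ∑ i, (if E i then -1 else 1) * d y i)) :=
          Finset.sum_le_sum fun E _ => hexp E
      _ = ∑ y ∈ T, (∑ E : α → Bool, Real.exp (l * ∑ i, (if E i then -1 else 1) * d y i)
        + ∑ E : α → Bool, Real.exp (-l * ∑ i, (if E i then -1 else 1) * d y i)) := by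
          rw [Finset.sum_comm]
          simp_rw [Finset.sum_add_distrib]
      _ ≤ ∑ y ∈ T, (2 ^ Fintype.card α * Real.exp L + 2 ^ Fintype.card α * Real.exp L) := by
          refine Finset.sum_le_sum fun y hy => ?_
          have h1 := sum_signs_exp_le (d y) (hd y hy) l
          have h2 := sum_signs_exp_le (d y) (hd y hy) (-l)
          rw [← hk, hll] at h1
          rw [← hk, neg_sq, hll] at h2
          exact add_le_add h1 h2
      _ = _ := by
          rw [Finset.sum_const, nsmul_eq_mul]
          ring
  have hjensen := convexOn_exp.map_sum_le (t := (Finset.univ : Finset (α → Bool)))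
    (w := fun _ => ((2 : ℝ) ^ Fintype.card α)⁻¹) (p := fun E => l * Z E)
    (fun _ _ => by positivity) (by simp) (fun _ _ => Set.mem_univ _)
  simp only [smul_eq_mul, ← Finset.mul_sum] at hjensen
  have hmain : Real.exp ((2 ^ Fintype.card α)⁻¹ * (l * ∑ E, Z E)) ≤ Real.exp (2 * L) := by
    refine hjensen.trans ?_
    rw [inv_mul_le_iff₀ (by positivity)]
    refine hsum.trans_eq ?_
    rw [two_mul L, Real.exp_add, hL, Real.exp_log (by linarith)]
  have h := Real.exp_le_exp.1 hmain
  rw [inv_mul_le_iff₀ (by positivity)] at h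
  have : l * ∑ E, Z E ≤ l * (2 ^ Fintype.card α * s) := by
    refine h.trans_eq ?_
    rw [hl]
    field_simp
  exact le_of_mul_le_mul_left this hl0

/-! ### Symmetrization under random permutations. -/

/-- The average of `f` over the orbit of any index under all permutations is the average of `f`. -/
theorem card_mul_sum_perm {β : Type*} [Fintype β] [DecidableEq β] (f : β → ℝ) (b : β) :
    Fintype.card β * ∑ τ : Equiv.Perm β, f (τ b) = Fintype.card (Equiv.Perm β) * ∑ i, f i := by
  have h1 : ∀ c, ∑ τ : Equiv.Perm β, f (τ c) = ∑ τ : Equiv.Perm β, f (τ b) := by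
    intro c
    rw [← Equiv.sum_comp (Equiv.mulRight (Equiv.swap b c)) (fun τ : Equiv.Perm β => f (τ c))]
    simp
  calc _ = ∑ c : β, ∑ τ : Equiv.Perm β, f (τ c) := by simp [h1]
    _ = ∑ τ : Equiv.Perm β, ∑ c : β, f (τ c) := Finset.sum_comm
    _ = _ := by simp [Equiv.sum_comp]

/-- The permutation of `α ⊕ (α ⊕ γ)` that exchanges the two copies of each index in `E`. -/
def swapCopies {α γ : Type*} (E : α → Bool) : Equiv.Perm (α ⊕ (α ⊕ γ)) :=
  Function.Involutive.toPerm
    (fun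
      | .inl i => if E i then .inr (.inl i) else .inl i
      | .inr (.inl i) => if E i then .inl i else .inr (.inl i)
      | .inr (.inr j) => .inr (.inr j))
    (by
      rintro (i | i | j)
      · by_cases h : E i <;> simp [h]
      · by_cases h : E i <;> simp [h]
      · rfl)

theorem swapCopies_inl {α γ : Type*} (E : α → Bool) (i : α) :
    swapCopies (γ := γ) E (.inl i) = if E i then .inr (.inl i) else .inl i := rfl

theorem swapCopies_inr_inl {α γ : Type*} (E : α → Bool) (i : α) :
    swapCopies (γ := γ) E (.inr (.inl i)) = if E i then .inl i else .inr (.inl i) := rfl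

/-- Right multiplication by `swapCopies E` permutes the summands `σ` and flips the sign of the
`i`-th difference exactly when `E i`. Averaging over `E` gives, for each fixed `σ`, a Rademacher sum
with coefficients bounded by `2 * c`. -/
theorem sum_perm_sup'_sum_sub_le {α γ κ : Type*} [Fintype α] [DecidableEq α] [Nonempty α]
    [Fintype γ] [DecidableEq γ] {T : Finset κ} (hT : T.Nonempty) (f : κ → α ⊕ (α ⊕ γ) → ℝ)
    {c : ℝ} (hc : 0 < c) (hf : ∀ y ∈ T, ∀ x, |f y x| ≤ c) :
    ∑ σ : Equiv.Perm (α ⊕ (α ⊕ γ)),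
        T.sup' hT (fun y => |∑ i, (f y (σ (.inr (.inl i))) - f y (σ (.inl i)))|)
      ≤ Fintype.card (Equiv.Perm (α ⊕ (α ⊕ γ)))
        * (2 * c * √(2 * Fintype.card α * Real.log (2 * T.card))) := by
  set F : Equiv.Perm (α ⊕ (α ⊕ γ)) → ℝ := fun σ =>
    T.sup' hT (fun y => |∑ i, (f y (σ (.inr (.inl i))) - f y (σ (.inl i)))|) with hF
  have hswap : ∀ E : α → Bool, ∑ σ, F σ = ∑ σ, F (σ * swapCopies E) := fun E =>
    (Equiv.sum_comp (Equiv.mulRight (swapCopies E)) F).symm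
  have hsign : ∀ (E : α → Bool) (σ : Equiv.Perm (α ⊕ (α ⊕ γ))), F (σ * swapCopies E) =
      T.sup' hT (fun y => |∑ i, (if E i then -1 else 1)
        * (f y (σ (.inr (.inl i))) - f y (σ (.inl i)))|) := by
    intro E σ
    simp only [hF]
    congr 1
    ext y
    congr 1
    refine Finset.sum_congr rfl fun i _ => ?_
    by_cases h : E i <;> simp [swapCopies_inl, swapCopies_inr_inl, h]
  have h2 : (2 : ℝ) ^ Fintype.card α * ∑ σ, F σ
      = ∑ σ, ∑ E : α → Bool, F (σ * swapCopies E) := by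
    rw [Finset.sum_comm, ← Finset.sum_congr rfl (fun E _ => hswap E)]
    simp
  have h3 : ∀ σ, ∑ E : α → Bool, F (σ * swapCopies E) ≤ 2 ^ Fintype.card α
      * (2 * c * √(2 * Fintype.card α * Real.log (2 * T.card))) := by
    intro σ
    simp_rw [hsign]
    refine sum_signs_sup'_abs_le hT
      (fun y i => f y (σ (.inr (.inl i))) - f y (σ (.inl i))) (by positivity) fun y hy i => ?_
    refine (abs_sub _ _).trans ?_
    linarith [hf y hy (σ (.inr (.inl i))), hf y hy (σ (.inl i))]
  have h4 := Finset.sum_le_sum fun σ (_ : σ ∈ Finset.univ) => h3 σ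
  rw [← h2, Finset.sum_const, Finset.card_univ, nsmul_eq_mul] at h4
  refine le_of_mul_le_mul_left (h4.trans_eq ?_) (show (0 : ℝ) < 2 ^ Fintype.card α by positivity)
  ring

/-- The mean over `α ⊕ γ` equals the mean, over permutations `τ` of that block, of the mean over its
part `α`. The triangle inequality moves the average over `τ` outside the supremum, and translation
by `R τ` leaves the sum over `σ` unchanged. -/
theorem sum_perm_sup'_avg_sub_le_sum {α γ κ : Type*} [Fintype α] [DecidableEq α] [Nonempty α]
    [Fintype γ] [DecidableEq γ] {T : Finset κ} (hT : T.Nonempty) (f : κ → α ⊕ (α ⊕ γ) → ℝ) :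
    ∑ σ : Equiv.Perm (α ⊕ (α ⊕ γ)), T.sup' hT (fun y =>
        |(∑ b, f y (σ (.inr b))) / Fintype.card (α ⊕ γ)
          - (∑ i, f y (σ (.inl i))) / Fintype.card α|)
      ≤ (∑ σ : Equiv.Perm (α ⊕ (α ⊕ γ)),
        T.sup' hT (fun y => |∑ i, (f y (σ (.inr (.inl i))) - f y (σ (.inl i)))|))
          / Fintype.card α := by
  set F : Equiv.Perm (α ⊕ (α ⊕ γ)) → ℝ := fun σ =>
    T.sup' hT (fun y => |∑ i, (f y (σ (.inr (.inl i))) - f y (σ (.inl i)))|) with hF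
  set K : ℝ := (Fintype.card α : ℝ) with hK
  set M : ℝ := (Fintype.card (α ⊕ γ) : ℝ) with hM
  set P : ℝ := (Fintype.card (Equiv.Perm (α ⊕ γ)) : ℝ) with hP
  have hK0 : 0 < K := by rw [hK]; exact_mod_cast Fintype.card_pos
  have hM0 : 0 < M := by rw [hM]; exact_mod_cast Fintype.card_pos
  have hP0 : 0 < P := by rw [hP]; exact_mod_cast Fintype.card_pos
  let R : Equiv.Perm (α ⊕ γ) → Equiv.Perm (α ⊕ (α ⊕ γ)) := fun τ => Equiv.sumCongr 1 τ
  have havg : ∀ y (σ : Equiv.Perm (α ⊕ (α ⊕ γ))), P * K *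
      ((∑ b, f y (σ (.inr b))) / M - (∑ i, f y (σ (.inl i))) / K)
      = ∑ τ, ∑ i, (f y ((σ * R τ) (.inr (.inl i))) - f y ((σ * R τ) (.inl i))) := by
    intro y σ
    simp only [Finset.sum_sub_distrib, R, Equiv.Perm.mul_apply, Equiv.sumCongr_apply,
      Sum.map_inl, Sum.map_inr, Equiv.Perm.one_apply]
    rw [Finset.sum_comm]
    have h1 : ∀ i : α, ∑ τ : Equiv.Perm (α ⊕ γ), f y (σ (.inr (τ (.inl i))))
        = P * (∑ b, f y (σ (.inr b))) / M := by
      intro i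
      rw [eq_div_iff hM0.ne', mul_comm]
      exact card_mul_sum_perm (fun b => f y (σ (.inr b))) (.inl i)
    simp only [h1, Finset.sum_const, Finset.card_univ, nsmul_eq_mul, ← hK, ← hP]
    field_simp
  have hle : ∀ σ : Equiv.Perm (α ⊕ (α ⊕ γ)), P * K * T.sup' hT (fun y =>
      |(∑ b, f y (σ (.inr b))) / M - (∑ i, f y (σ (.inl i))) / K|) ≤ ∑ τ, F (σ * R τ) := by
    intro σ
    obtain ⟨y, hy, hyZ⟩ := T.exists_mem_eq_sup' hT (fun y =>
      |(∑ b, f y (σ (.inr b))) / M - (∑ i, f y (σ (.inl i))) / K|)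
    rw [hyZ, ← abs_of_pos (mul_pos hP0 hK0), ← abs_mul, havg]
    refine (Finset.abs_sum_le_sum_abs _ _).trans (Finset.sum_le_sum fun τ _ => ?_)
    exact T.le_sup' (fun y => |∑ i, (f y ((σ * R τ) (.inr (.inl i)))
      - f y ((σ * R τ) (.inl i)))|) hy
  have hinv : ∑ σ, ∑ τ, F (σ * R τ) = P * ∑ σ, F σ := by
    have h1 : ∀ τ, ∑ σ, F (σ * R τ) = ∑ σ, F σ := fun τ =>
      Equiv.sum_comp (Equiv.mulRight (R τ)) F
    rw [Finset.sum_comm, Finset.sum_congr rfl fun τ _ => h1 τ, Finset.sum_const,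
      Finset.card_univ, nsmul_eq_mul]
  have h := Finset.sum_le_sum fun σ (_ : σ ∈ Finset.univ) => hle σ
  rw [← Finset.mul_sum, hinv, mul_assoc] at h
  rw [le_div_iff₀' hK0]
  exact le_of_mul_le_mul_left h hP0

/-- The expected uniform deviation, over a finite class, between the averages over a block and over
its complement, for a uniformly random permutation; the block is the smaller of the two. -/
theorem sum_perm_sup'_avg_sub_le {α γ κ ι : Type*} [Fintype α] [DecidableEq α] [Nonempty α]
    [Fintype γ] [DecidableEq γ] [Fintype ι] [DecidableEq ι] (e : α ⊕ (α ⊕ γ) ≃ ι)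
    {T : Finset κ} (hT : T.Nonempty) (f : κ → ι → ℝ)
    {c : ℝ} (hc : 0 < c) (hf : ∀ y ∈ T, ∀ x, |f y x| ≤ c) :
    (∑ σ : Equiv.Perm ι, T.sup' hT (fun y =>
        |(∑ b, f y (σ (e (.inr b)))) / Fintype.card (α ⊕ γ)
          - (∑ i, f y (σ (e (.inl i)))) / Fintype.card α|)) / Fintype.card (Equiv.Perm ι)
      ≤ 2 * c * √(2 * Real.log (2 * T.card)) / √(Fintype.card α) := by
  have hK0 : (0 : ℝ) < Fintype.card α := by exact_mod_cast Fintype.card_pos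
  have hP0 : (0 : ℝ) < Fintype.card (Equiv.Perm ι) := by exact_mod_cast Fintype.card_pos
  have h := (sum_perm_sup'_avg_sub_le_sum hT (fun y x => f y (e x))).trans
    (div_le_div_of_nonneg_right
      (sum_perm_sup'_sum_sub_le hT (fun y x => f y (e x)) hc fun y hy x => hf y hy (e x)) hK0.le)
  -- Conjugation by `e` identifies the permutations of `ι` with those of the sum type.
  rw [← Equiv.sum_comp e.permCongr, div_le_iff₀ hP0, ← Fintype.card_congr e.permCongr]
  simp only [Equiv.permCongr_apply, Equiv.symm_apply_apply]
  refine h.trans_eq ?_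
  have hs : √(2 * (Fintype.card α : ℝ) * Real.log (2 * T.card))
      = √(Fintype.card α) * √(2 * Real.log (2 * T.card)) := by
    rw [← Real.sqrt_mul hK0.le]
    ring_nf
  have hs0 : √(Fintype.card α : ℝ) ≠ 0 := (Real.sqrt_pos.2 hK0).ne'
  rw [hs, div_eq_iff hK0.ne', div_mul_eq_mul_div, div_mul_eq_mul_div, eq_div_iff hs0]
  linear_combination Fintype.card (Equiv.Perm (α ⊕ (α ⊕ γ))) * 2 * c
    * √(2 * Real.log (2 * T.card)) * Real.mul_self_sqrt hK0.le

/-! ### Prefix and suffix blocks. -/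

/-- A predicate on `n` indices that holds for exactly `k ≤ n / 2` of them splits the indices into
two blocks of size `k`, the first of which is given by the predicate, and a remainder. -/
theorem exists_equiv_sum_of_card {n k : ℕ} (p : Fin n → Prop) [DecidablePred p]
    (hp : Fintype.card {j // p j} = k) (hk : 2 * k ≤ n) :
    ∃ e : Fin k ⊕ (Fin k ⊕ Fin (n - 2 * k)) ≃ Fin n,
      (∀ f : Fin n → ℝ, ∑ i, f (e (.inl i)) = ∑ j with p j, f j) ∧
      ∀ f : Fin n → ℝ, ∑ b, f (e (.inr b)) = ∑ j with ¬p j, f j := by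
  have hq : Fintype.card {j // ¬p j} = Fintype.card (Fin k ⊕ Fin (n - 2 * k)) := by
    rw [Fintype.card_subtype_compl, hp]
    simp
    omega
  let e₁ : Fin k ≃ {j // p j} := (Fintype.equivFinOfCardEq hp).symm
  let e₂ : Fin k ⊕ Fin (n - 2 * k) ≃ {j // ¬p j} := (Fintype.equivOfCardEq hq).symm
  refine ⟨(Equiv.sumCongr e₁ e₂).trans (Equiv.sumCompl p), fun f => ?_, fun f => ?_⟩
  · simp only [Equiv.trans_apply, Equiv.sumCongr_apply, Sum.map_inl, Equiv.sumCompl_apply_inl]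
    rw [Equiv.sum_comp e₁ (fun j => f j)]
    exact (Finset.sum_subtype _ (by simp) f).symm
  · simp only [Equiv.trans_apply, Equiv.sumCongr_apply, Sum.map_inr, Equiv.sumCompl_apply_inr]
    rw [Equiv.sum_comp e₂ (fun j => f j)]
    exact (Finset.sum_subtype _ (by simp) f).symm

/-- The uniform deviation between the averages over the block `p` and over its complement. -/
theorem permExpectation_sup'_block_le {n k : ℕ} {κ : Type*} (p : Fin n → Prop) [DecidablePred p]
    (hp : Fintype.card {j // p j} = k) (hk0 : 0 < k) (hk : 2 * k ≤ n)
    {T : Finset κ} (hT : T.Nonempty) (f : κ → Fin n → ℝ)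
    {c : ℝ} (hc : 0 < c) (hf : ∀ y ∈ T, ∀ x, |f y x| ≤ c) :
    permExpectation (fun σ : Equiv.Perm (Fin n) => T.sup' hT (fun y =>
        |(∑ j with ¬p j, f y (σ j)) / ((n : ℝ) - k) - (∑ j with p j, f y (σ j)) / k|))
      ≤ 2 * c * √(2 * Real.log (2 * T.card)) / √k := by
  obtain ⟨e, he₁, he₂⟩ := exists_equiv_sum_of_card p hp hk
  have : Nonempty (Fin k) := ⟨⟨0, hk0⟩⟩
  have h := sum_perm_sup'_avg_sub_le e hT f hc hf
  have hcard : (Fintype.card (Fin k ⊕ Fin (n - 2 * k)) : ℝ) = (n : ℝ) - k := by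
    rw [Fintype.card_sum, Fintype.card_fin, Fintype.card_fin, ← Nat.cast_sub (by omega)]
    congr 1
    omega
  rw [hcard, Fintype.card_fin, Fintype.card_perm, Fintype.card_fin] at h
  unfold permExpectation
  convert h using 7 with σ _ y
  · exact (he₂ fun j => f y (σ j)).symm
  · exact (he₁ fun j => f y (σ j)).symm

theorem permExpectation_mono {n : ℕ} {X Y : Equiv.Perm (Fin n) → ℝ} (h : ∀ σ, X σ ≤ Y σ) :
    permExpectation X ≤ permExpectation Y :=
  div_le_div_of_nonneg_right (Finset.sum_le_sum fun σ _ => h σ) (by positivity)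

/-- The uniform deviation between prefix and suffix averages over a finite class. -/
theorem permExpectation_sup'_avg_le {n t : ℕ} {κ : Type*} (ht : 1 ≤ t) (htn : t < n)
    {T : Finset κ} (hT : T.Nonempty) (f : κ → Fin n → ℝ)
    {c : ℝ} (hc : 0 < c) (hf : ∀ y ∈ T, ∀ x, |f y x| ≤ c) :
    permExpectation (fun σ : Equiv.Perm (Fin n) => T.sup' hT (fun y =>
        |suffixAvg t (fun j => f y (σ j)) - prefixAvg t (fun j => f y (σ j))|))
      ≤ 2 * c * √(2 * Real.log (2 * T.card)) / √(min (t : ℝ) ((n : ℝ) - t)) := by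
  have hcard : Fintype.card {j : Fin n // j.val < t} = t := by
    rw [Fintype.card_subtype]
    simp [Fin.card_filter_val_lt, htn.le]
  -- The distinguished block has to be the shorter one; the absolute difference is symmetric, so the
  -- suffix can take that role.
  rcases le_total (2 * t) n with h | h
  · have hmin : min (t : ℝ) ((n : ℝ) - t) = t := by
      refine min_eq_left ?_
      have : (2 * t : ℝ) ≤ n := by exact_mod_cast h
      linarith
    rw [hmin]
    refine le_trans (permExpectation_mono fun σ => le_of_eq ?_)
      (permExpectation_sup'_block_le (fun j => j.val < t) hcard ht h hT f hc hf)
    simp only [suffixAvg, prefixAvg, not_lt, one_div, inv_mul_eq_div]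
  · have hcast : ((n - t : ℕ) : ℝ) = (n : ℝ) - t := Nat.cast_sub htn.le
    have hmin : min (t : ℝ) ((n : ℝ) - t) = ((n - t : ℕ) : ℝ) := by
      rw [hcast]
      refine min_eq_right ?_
      have : (n : ℝ) ≤ 2 * t := by exact_mod_cast h
      linarith
    have hcard' : Fintype.card {j : Fin n // ¬ j.val < t} = n - t := by
      rw [Fintype.card_subtype_compl, hcard, Fintype.card_fin]
    rw [hmin]
    refine le_trans (permExpectation_mono fun σ => le_of_eq ?_)
      (permExpectation_sup'_block_le (fun j => ¬ j.val < t) hcard' (by omega) (by omega)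
        hT f hc hf)
    simp only [suffixAvg, prefixAvg, not_lt, not_le, one_div, inv_mul_eq_div, hcast, sub_sub_cancel,
      abs_sub_comm]

/-! ### Constants and the passage from prices to the finite family. -/

/-- Source of the constant 4: `log (2 * N) ≤ log 4 + m * log n` with `log 4 ≤ 2`, followed by `√(4 +
x) ≤ 2 + √x`. -/
theorem two_mul_sqrt_log_le {n m N : ℕ} (hn : 2 ≤ n) (hN : 1 ≤ N) (hNn : N ≤ 2 * n ^ m) {c : ℝ}
    (hc : 0 ≤ c) :
    2 * c * √(2 * Real.log (2 * N)) ≤ 4 * c + 2 * √(2 * c ^ 2 * m * Real.log n) := by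
  have hN' : (1 : ℝ) ≤ N := by exact_mod_cast hN
  have hn' : (2 : ℝ) ≤ n := by exact_mod_cast hn
  have hNn' : (N : ℝ) ≤ 2 * n ^ m := by exact_mod_cast hNn
  have hlogn : 0 ≤ Real.log n := Real.log_nonneg (by linarith)
  have hlog : Real.log (2 * N) ≤ 2 + m * Real.log n := by
    have h4 : Real.log 4 ≤ 2 := by
      rw [show (4 : ℝ) = 2 ^ 2 by norm_num, Real.log_pow]
      have := Real.log_two_lt_d9
      push_cast
      linarith
    calc Real.log (2 * N) ≤ Real.log (4 * n ^ m) := Real.log_le_log (by linarith) (by linarith)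
      _ = Real.log 4 + m * Real.log n := by
        rw [Real.log_mul (by norm_num) (by positivity), Real.log_pow]
      _ ≤ _ := by linarith
  have hsqrt : √(2 * Real.log (2 * N)) ≤ 2 + √(2 * m * Real.log n) := by
    have h0 : 0 ≤ 2 * m * Real.log n := by positivity
    refine Real.sqrt_le_iff.2 ⟨by positivity, ?_⟩
    nlinarith [Real.sq_sqrt h0, Real.sqrt_nonneg (2 * m * Real.log n)]
  have hpull : √(2 * c ^ 2 * m * Real.log n) = c * √(2 * m * Real.log n) := by
    rw [show 2 * c ^ 2 * m * Real.log n = c ^ 2 * (2 * m * Real.log n) by ring,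
      Real.sqrt_mul (sq_nonneg c), Real.sqrt_sq hc]
  rw [hpull]
  linarith [mul_le_mul_of_nonneg_left hsqrt hc]

theorem permExpectation_supGap_le {m n t : ℕ} (ht : 1 ≤ t) (htn : t < n) (c r : Fin n → ℝ)
    (a : Fin n → Fin m → ℝ) {C : ℝ} (hc : ∀ j, |c j| ≤ C) :
    permExpectation (fun σ : Equiv.Perm (Fin n) =>
        supGap t (fun j => c (σ j)) (fun j => r (σ j)) (fun j => a (σ j)))
      ≤ 4 * C / √(min (t : ℝ) ((n : ℝ) - t))
        + 2 * √(2 * C ^ 2 * m * Real.log n) / √(min (t : ℝ) ((n : ℝ) - t)) := by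
  classical
  have hC : 0 ≤ C := (abs_nonneg _).trans (hc ⟨0, by omega⟩)
  -- Accepted sets are recorded by original column index, so the family does not depend on `σ`.
  set f : Finset (Fin n) → Fin n → ℝ := fun s j => c j * if j ∈ s then 1 else 0 with hf
  have hmem : ∀ p : {p : Fin m → ℝ // 0 ≤ p},
      (Finset.univ.filter fun j => r j > a j ⬝ᵥ p.1) ∈ acceptFamily r a := by
    intro p
    simp only [acceptFamily, Finset.mem_filter, Finset.mem_univ, true_and]
    exact ⟨p.1, p.2, fun _ => Iff.rfl⟩
  have hT : (acceptFamily r a).Nonempty := ⟨_, hmem ⟨0, le_rfl⟩⟩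
  have hle : ∀ σ : Equiv.Perm (Fin n),
      supGap t (fun j => c (σ j)) (fun j => r (σ j)) (fun j => a (σ j))
        ≤ (acceptFamily r a).sup' hT (fun s =>
          |suffixAvg t (fun j => f s (σ j)) - prefixAvg t (fun j => f s (σ j))|) := by
    intro σ
    have : Nonempty {p : Fin m → ℝ // 0 ≤ p} := ⟨⟨0, le_rfl⟩⟩
    refine ciSup_le fun p => ?_
    refine le_trans (le_of_eq ?_) (Finset.le_sup' (fun s =>
      |suffixAvg t (fun j => f s (σ j)) - prefixAvg t (fun j => f s (σ j))|) (hmem p))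
    simp [gap, accept, hf]
  have hmin : 0 < min (t : ℝ) ((n : ℝ) - t) := by
    refine lt_min (by exact_mod_cast ht) (sub_pos.2 (by exact_mod_cast htn))
  -- The Massart bound needs a positive bound on the values; for `C = 0` every `c j` vanishes.
  rcases hC.eq_or_lt with rfl | hC0
  · have hc0 : ∀ j, c j = 0 := fun j => abs_nonpos_iff.1 (hc j)
    simp [hc0, permExpectation, supGap, gap, suffixAvg, prefixAvg]
  · refine (permExpectation_mono hle).trans
      ((permExpectation_sup'_avg_le ht htn hT f hC0 fun s _ j => ?_).trans ?_)
    · refine le_trans ?_ (hc j)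
      simp only [hf]
      split_ifs <;> simp
    · rw [← add_div]
      gcongr
      exact two_mul_sqrt_log_le (by omega) hT.card_pos (card_acceptFamily_le (by omega) r a) hC

end RandomPermutationLP

theorem proposition2 (m n t : ℕ) (ht : 1 ≤ t) (htn : t ≤ n - 1)
    (r : Fin n → ℝ) (a : Fin n → Fin m → ℝ) (rbar abar : ℝ)
    (hr : ∀ j, |r j| ≤ rbar) (ha : ∀ j, ‖a j‖ ≤ abar) :
    RandomPermutationLP.permExpectation (fun σ : Equiv.Perm (Fin n) =>
        RandomPermutationLP.supGap t (fun j => r (σ j)) (fun j => r (σ j)) (fun j => a (σ j)))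
      ≤ 4 * rbar / √(min (t : ℝ) ((n : ℝ) - (t : ℝ)))
        + 2 * √(2 * rbar ^ 2 * (m : ℝ) * Real.log (n : ℝ)) / √(min (t : ℝ) ((n : ℝ) - (t : ℝ)))
    ∧ ∀ i : Fin m,
      RandomPermutationLP.permExpectation (fun σ : Equiv.Perm (Fin n) =>
          RandomPermutationLP.supGap t (fun j => a (σ j) i) (fun j => r (σ j)) (fun j => a (σ j)))
        ≤ 4 * abar / √(min (t : ℝ) ((n : ℝ) - (t : ℝ)))
          + 2 * √(2 * abar ^ 2 * (m : ℝ) * Real.log (n : ℝ))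
            / √(min (t : ℝ) ((n : ℝ) - (t : ℝ))) := by
  -- Truncated subtraction is harmless here: `1 ≤ t` excludes `n = 0`.
  have htn' : t < n := by omega
  exact ⟨RandomPermutationLP.permExpectation_supGap_le ht htn' r r a hr, fun i =>
    RandomPermutationLP.permExpectation_supGap_le ht htn' (fun j => a j i) r a fun j =>
      -- The norm on `Fin m → ℝ` is the sup norm, so it bounds each coordinate.
      (norm_le_pi_norm (a j) i).trans (ha j)⟩
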